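/- Let $1\le k\le p-1$ be integers, let $\mathbb{R}^p$ carry its canonical scalar product and norm, and let $e_1,\ldots,e_k\in\mathbb{R}^p$. Let $\tau_1,\ldots,\tau_k>0$ be pairwise distinct real numbers. Let $\omega_1,\ldots,\omega_k,\varphi_1,\ldots,\varphi_k$ be real numbers such that for infinitely many integers $n$ one has $n\omega_j+\varphi_j\not\equiv\frac{\pi}{2}\bmod\pi$ for all $j\in\{1,\ldots,k\}$. Let $(Q_n)_{n\ge1}$ be a non-decreasing sequence of positive integers tending to infinity (for example, a strictly increasing one) such that $Q_{n+1}=Q_n^{1+O(1/n)}$ as $n\to\infty$; if $\omega_1=\cdots=\omega_k=0$, this last assumption may be weakened to $Q_{n+1}=Q_n^{1+o(1)}$. For each $n\ge1$ let $L_n=\ell_{1,n}X_1+\cdots+\ell_{p,n}X_p$ be a linear form on $\mathbb{R}^p$ with integer coefficients such that, as $n\to\infty$, $$|L_n(e_j)|=Q_n^{-\tau_j+o(1)}\,\bigl|\cos(n\omega_j+\varphi_j)+o(1)\bigr|\quad\text{for every } j\in\{1,\ldots,k\},\qquad \max_{1\le i\le p}|\ell_{i,n}|\le Q_n^{1+o(1)}.$$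 Then: (i) If $F$ is a linear subspace of $\mathbb{R}^p$ that contains $e_1,\ldots,e_k$ and is defined over $\mathbb{Q}$ (that is, $F$ is the common zero locus of a family of linear forms with rational coefficients), then $\dim F\ge k+\tau_1+\cdots+\tau_k$. In other words, if $C_1,\ldots,C_p\in\mathbb{R}^k$ are the columns of the matrix whose rows are $e_1,\ldots,e_k$, then the $\mathbb{Q}$-linear span of $C_1,\ldots,C_p$ in $\mathbb{R}^k$ has dimension over $\mathbb{Q}$ at least $k+\tau_1+\cdots+\tau_k$. (ii) The vectors $e_1,\ldots,e_k$ are linearly independent over $\mathbb{R}$, and the $\mathbb{R}$-subspace they span does not intersect $\mathbb{Q}^p\setminus\{(0,\ldots,0)\}$. (iii) For every $\varepsilon>0$ and every sufficiently large real number $Q$ (in terms of $\varepsilon$), let $\mathcal{C}$ be the set of all vectors $\lambda_1e_1+\cdots+\lambda_ke_k+u$ with $\lambda_1,\ldots,\lambda_k\in\mathbb{R}$, $|\lambda_j|\le Q^{\tau_j}$ for all $j\in\{1,\ldots,k\}$, and $u\in(\mathrm{Span}_{\mathbb{R}}(e_1,\ldots,e_k))^\perp$, $\|u\|\le Q^{-1-\varepsilon}$.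 Then $\mathcal{C}\cap\mathbb{Z}^p=\{(0,\ldots,0)\}$. -/

import Mathlib

/-- The linear form `a₁ X₁ + ⋯ + a_p X_p` on `ℝᵖ` with integer coefficients `a`. -/
noncomputable def integerForm {p : ℕ} (a : Fin p → ℤ) : EuclideanSpace ℝ (Fin p) →ₗ[ℝ] ℝ where
  toFun x := ∑ i, (a i : ℝ) * x i
  map_add' x y := by simp [mul_add, Finset.sum_add_distrib]
  map_smul' c x := by simp [Finset.mul_sum, mul_left_comm]

/-- The set `ℤᵖ` inside `ℝᵖ`. -/
def integerPoints (p : ℕ) : Set (EuclideanSpace ℝ (Fin p)) :=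
  {x | ∃ m : Fin p → ℤ, ∀ i, x i = (m i : ℝ)}

/-- The set `ℚᵖ` inside `ℝᵖ`. -/
def rationalPoints (p : ℕ) : Set (EuclideanSpace ℝ (Fin p)) :=
  {x | ∃ r : Fin p → ℚ, ∀ i, x i = (r i : ℝ)}

/-- A subspace of `ℝᵖ` is defined over `ℚ` if it is the common zero locus of a family of
linear forms with rational coefficients. -/
def DefinedOverRat {p : ℕ} (F : Submodule ℝ (EuclideanSpace ℝ (Fin p))) : Prop :=
  ∃ S : Set (Fin p → ℚ), ∀ x : EuclideanSpace ℝ (Fin p),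
    x ∈ F ↔ ∀ a ∈ S, ∑ i, (a i : ℝ) * x i = 0

/-- The set of all `λ₁ e₁ + ⋯ + λ_k e_k + u` with `|λ_j| ≤ Q ^ τ_j` for all `j`, with `u`
orthogonal to the span of the `e_j`, and with `‖u‖ ≤ Q ^ (-1 - ε)`. -/
def convexBody {k p : ℕ} (e : Fin k → EuclideanSpace ℝ (Fin p)) (τ : Fin k → ℝ) (ε Q : ℝ) :
    Set (EuclideanSpace ℝ (Fin p)) :=
  {x | ∃ (c : Fin k → ℝ) (u : EuclideanSpace ℝ (Fin p)),
    (∀ j, |c j| ≤ Q ^ τ j) ∧ u ∈ (Submodule.span ℝ (Set.range e))ᗮ ∧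
      ‖u‖ ≤ Q ^ (-1 - ε) ∧ x = ∑ j, c j • e j + u}

/-!
Write `s = log Q_n` and work on the logarithmic scale. The cosine factors are almost periodic in
`n`: the powers of `(exp (i ω_j))_j` lie in a compact set, so the `n` at which all
`|cos (n ω_j + φ_j)|` exceed some fixed `c > 0` have bounded gaps
(`exists_bounded_gaps_le_abs_cos`). Since `log Q_{n+1} / log Q_n → 1`, such `n` still occur near
every scale (`eventually_exists_window`), and for them `|L_n(e_j)| = exp (-(τ_j + o(1)) s)`.
From there on only the property `HasFormsAtAllScales` is used.

The heart is `HasFormsAtAllScales.eventually_notMem_integerPoints`. Let `x = ∑ c_j e_j + u` be an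
integer point with `|c_j| ≤ exp (τ_j y)`, `‖u‖ ≤ exp (-(1 + ε) y)` and `y` large. Let `t ≤ y` be
the scale at which `max_j |c_j| exp (-τ_j t)` is about `1`. At each scale `s` slightly above `t`,
every `c_j L(e_j)` is small, and so is `L(u)`; hence the integer `L(x)` vanishes, and the sum of the
`c_j L(e_j)` is as small as `L(u)`, much smaller than its largest term. So two of the terms are
comparable. Among `k ^ 2 + 1` well separated scales, one pair `j ≠ j'` of comparable terms must
repeat; but the ratio of these terms varies like `exp (-(τ_j - τ_j') s)`, and `τ_j ≠ τ_j'`.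

If `x ≠ 0`, then the `c_j` cannot all be small, because `‖x‖ ≥ 1`. This gives the assertion on the
convex body; linear independence and the absence of rational points in the span follow by letting
`y → ∞` with `c` fixed. For the dimension, a subspace spanned by rational points and containing the
`e_j` has a basis of integer vectors, and Minkowski's theorem in this lattice would produce a
nonzero integer point in the convex body if the dimension were less than `k + ∑ τ_j`
(`HasFormsAtAllScales.le_finrank_span`). Expanding real vectors along a `ℚ`-basis of the span of
their coordinates shows that subspaces defined over `ℚ` are of this kind, and that the
`ℚ`-rank of the columns bounds the dimension of such a subspace.
-/

open Filter

/-! ### Forms at all scales and comparison of terms -/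

/-- Linear forms with integer coefficients of size about `exp s` whose values at `e j` have size
about `exp (-τ j * s)`, the logarithmic size `s` being available up to a factor close to `1` near
every large real number `t`. -/
def HasFormsAtAllScales {k p : ℕ} (e : Fin k → EuclideanSpace ℝ (Fin p)) (τ : Fin k → ℝ) : Prop :=
  ∀ η : ℝ, 0 < η → ∀ᶠ t : ℝ in atTop, ∃ (a : Fin p → ℤ) (s : ℝ), t ≤ s ∧ s ≤ (1 + η) * t ∧
    (∀ j, integerForm a (e j) ≠ 0 ∧ |Real.log |integerForm a (e j)| + τ j * s| ≤ η * s) ∧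
    ∀ i, |(a i : ℝ)| ≤ Real.exp ((1 + η) * s)

/-- Either no term exceeds twice the sum in absolute value, or two of the terms are nonzero and
comparable. -/
lemma half_abs_le_abs_sum_or_exists_comparable {k : ℕ} (a : Fin k → ℝ) (ha : ∃ j, a j ≠ 0) :
    (∀ j, |a j| / 2 ≤ |∑ i, a i|) ∨
      ∃ j j', j ≠ j' ∧ a j ≠ 0 ∧ a j' ≠ 0 ∧ |a j'| ≤ |a j| ∧ |a j| ≤ 2 * k * |a j'| := by
  obtain ⟨j₀, hj₀⟩ := ha
  have hk : (0 : ℝ) < k := by exact_mod_cast j₀.pos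
  obtain ⟨m, -, hm⟩ := Finset.exists_max_image Finset.univ (fun j => |a j|) ⟨j₀, Finset.mem_univ _⟩
  have ham : 0 < |a m| := (abs_pos.2 hj₀).trans_le (hm j₀ (Finset.mem_univ _))
  by_cases h : ∃ j', j' ≠ m ∧ |a m| ≤ 2 * k * |a j'|
  · obtain ⟨j', hne, hj'⟩ := h
    refine Or.inr ⟨m, j', hne.symm, abs_pos.1 ham, ?_, hm _ (Finset.mem_univ _), hj'⟩
    rintro h0
    rw [h0, abs_zero, mul_zero] at hj'
    linarith
  · push Not at h
    left
    intro j
    have h1 : ∑ i ∈ Finset.univ.erase m, |a i| ≤ |a m| / 2 := by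
      calc ∑ i ∈ Finset.univ.erase m, |a i|
          ≤ ∑ i ∈ Finset.univ.erase m, |a m| / (2 * k) := by
            refine Finset.sum_le_sum fun i hi => ?_
            rw [le_div_iff₀ (by positivity)]
            linarith [h i (Finset.ne_of_mem_erase hi)]
        _ ≤ ∑ i : Fin k, |a m| / (2 * k) :=
            Finset.sum_le_sum_of_subset_of_nonneg (Finset.erase_subset _ _)
              fun _ _ _ => by positivity
        _ = |a m| / 2 := by
            simp only [Finset.sum_const, Finset.card_univ, Fintype.card_fin, nsmul_eq_mul]
            field_simp
    have h2 : |∑ i ∈ Finset.univ.erase m, a i| ≤ |a m| / 2 :=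
      (Finset.abs_sum_le_sum_abs _ _).trans h1
    rw [← Finset.add_sum_erase _ _ (Finset.mem_univ m)]
    have h3 := abs_sub_abs_le_abs_sub (a m) (-∑ i ∈ Finset.univ.erase m, a i)
    rw [abs_neg, sub_neg_eq_add] at h3
    linarith [hm j (Finset.mem_univ _)]

/-- If `x * u` and `y * v` are comparable, where `u` and `v` have size about `exp (-α * s)` and
`exp (-β * s)`, then `x / y` has size about `exp ((α - β) * s)`. -/
lemma log_ratio_near {C x y u v α β s η : ℝ} (hx : x ≠ 0) (hy : y ≠ 0)
    (hu : u ≠ 0) (hv : v ≠ 0) (h1 : |y * v| ≤ |x * u|) (h2 : |x * u| ≤ C * |y * v|)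
    (hC : 0 < C)
    (hα : |Real.log |u| + α * s| ≤ η * s) (hβ : |Real.log |v| + β * s| ≤ η * s) :
    |Real.log |x| - Real.log |y| - (α - β) * s| ≤ Real.log C + 2 * (η * s) := by
  have hx' := abs_pos.2 hx
  have hy' := abs_pos.2 hy
  have hu' := abs_pos.2 hu
  have hv' := abs_pos.2 hv
  rw [abs_mul, abs_mul] at h1 h2
  have g1 := Real.log_le_log (by positivity) h1
  have g2 := Real.log_le_log (by positivity) h2
  rw [Real.log_mul hy'.ne' hv'.ne', Real.log_mul hx'.ne' hu'.ne'] at g1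
  rw [Real.log_mul hC.ne' (by positivity), Real.log_mul hy'.ne' hv'.ne',
    Real.log_mul hx'.ne' hu'.ne'] at g2
  rw [abs_le] at hα hβ ⊢
  constructor <;> linarith [hα.1, hα.2, hβ.1, hβ.2]

/-- A pair of distinct exponents cannot give comparable terms at two separated scales: here `B` is
the difference of the exponents, and `A` the logarithm of the ratio of the coefficients. -/
lemma not_comparable_twice {A B C s s' η δ σ : ℝ} (hσ : σ ≤ |B|)
    (hs : (1 + δ) * s ≤ s') (hδ : 0 < δ) (hη : 8 * η * (1 + δ) ≤ σ * δ) (h0 : 0 ≤ s)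
    (hη0 : 0 < η)
    (hlarge : 4 * C * (1 + δ) < σ * δ * s')
    (h1 : |A - B * s| ≤ C + 2 * (η * s)) (h2 : |A - B * s'| ≤ C + 2 * (η * s')) : False := by
  have h3 : |B * (s' - s)| ≤ 2 * C + 2 * (η * s) + 2 * (η * s') := by
    have : B * (s' - s) = (A - B * s) - (A - B * s') := by ring
    rw [this]
    linarith [abs_sub (A - B * s) (A - B * s')]
  have hss : s ≤ s' := by nlinarith
  rw [abs_mul, abs_of_nonneg (sub_nonneg.2 hss)] at h3
  have h4 : σ * (s' - s) ≤ 2 * C + 4 * (η * s') := by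
    have := mul_le_mul_of_nonneg_right hσ (sub_nonneg.2 hss)
    nlinarith
  have hσ0 : 0 < σ := by
    by_contra h
    push Not at h
    nlinarith [mul_pos hη0 (by linarith : (0:ℝ) < 1 + δ)]
  -- `s' - s ≥ δ s' / (1 + δ)`
  have h5 : δ * s' ≤ (1 + δ) * (s' - s) := by linarith
  have h6 : σ * δ * s' ≤ (1 + δ) * (2 * C + 4 * (η * s')) := by nlinarith
  nlinarith [mul_le_mul_of_nonneg_right hη (h0.trans hss)]

/-- The scale at which the largest of the terms `c j * exp (-τ j * t)` has size about `1`. -/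
lemma exists_balancing_scale {k : ℕ} (τ : Fin k → ℝ) (hτ : ∀ j, 0 < τ j) {S t₀ b : ℝ}
    (hS : ∀ j, τ j ≤ S) (ht₀ : 0 < t₀) (hb : 0 < b) :
    ∃ K : ℝ, ∀ (c : Fin k → ℝ) (y : ℝ), t₀ ≤ y → (∀ j, |c j| ≤ Real.exp (τ j * y)) →
      (∃ j, b ≤ |c j|) → ∃ t, t₀ ≤ t ∧ t ≤ y ∧ (∀ j, |c j| ≤ Real.exp (τ j * t)) ∧
        ∃ j, Real.exp (τ j * t - K) ≤ |c j| := by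
  refine ⟨max 0 (S * t₀ - Real.log b), fun c y hy hc ⟨j₀, hj₀⟩ => ?_⟩
  obtain ⟨m, -, hm⟩ := Finset.exists_max_image Finset.univ (fun j => Real.log |c j| / τ j)
    ⟨j₀, Finset.mem_univ _⟩
  refine ⟨max t₀ (Real.log |c m| / τ m), le_max_left _ _, max_le hy ?_, fun j => ?_, ?_⟩
  · rw [div_le_iff₀ (hτ m)]
    by_cases h : c m = 0
    · simp only [h, abs_zero, Real.log_zero]
      have := hτ m
      nlinarith
    · have := Real.log_le_log (abs_pos.2 h) (hc m)
      rw [Real.log_exp] at this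
      linarith
  · by_cases h : c j = 0
    · rw [h, abs_zero]
      positivity
    · rw [← Real.log_le_iff_le_exp (abs_pos.2 h), mul_comm, ← div_le_iff₀ (hτ j)]
      exact (hm j (Finset.mem_univ _)).trans (le_max_right _ _)
  · rcases le_total t₀ (Real.log |c m| / τ m) with h | h
    · refine ⟨m, ?_⟩
      rw [max_eq_right h]
      have h0 : 0 < |c m| := by
        refine abs_pos.2 fun h0 => ?_
        rw [h0, abs_zero, Real.log_zero, zero_div] at h
        linarith
      rw [← Real.le_log_iff_exp_le h0, mul_div_cancel₀ _ (hτ m).ne']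
      linarith [le_max_left 0 (S * t₀ - Real.log b)]
    · refine ⟨j₀, ?_⟩
      rw [max_eq_left h]
      refine le_trans ?_ hj₀
      rw [← Real.le_log_iff_exp_le hb]
      have := mul_le_mul_of_nonneg_right (hS j₀) ht₀.le
      linarith [le_max_right 0 (S * t₀ - Real.log b)]

lemma exists_exponent_bounds {k : ℕ} (τ : Fin k → ℝ) (hτ : ∀ j, 0 < τ j)
    (hinj : Function.Injective τ) :
    ∃ σ S : ℝ, 0 < σ ∧ 1 ≤ S ∧ (∀ j, σ ≤ τ j) ∧ (∀ j, τ j ≤ S) ∧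
      ∀ j j', j ≠ j' → σ ≤ |τ j - τ j'| := by
  have h1 : ∀ᶠ σ : ℝ in nhdsWithin 0 (Set.Ioi 0), ∀ j, σ ≤ τ j :=
    eventually_all.2 fun j => nhdsWithin_le_nhds (eventually_le_nhds (hτ j))
  have h2 : ∀ᶠ σ : ℝ in nhdsWithin 0 (Set.Ioi 0), ∀ j j', j ≠ j' → σ ≤ |τ j - τ j'| := by
    refine eventually_all.2 fun j => eventually_all.2 fun j' => ?_
    by_cases h : j = j'
    · exact Eventually.of_forall fun _ h' => (h' h).elim
    · filter_upwards [nhdsWithin_le_nhds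
        (eventually_le_nhds (abs_pos.2 (sub_ne_zero.2 (hinj.ne h))))] with σ hσ _ using hσ
  obtain ⟨σ, ⟨hσ1, hσ2⟩, hσ0⟩ := ((h1.and h2).and self_mem_nhdsWithin).exists
  obtain ⟨S, hS⟩ := Finite.bddAbove_range τ
  exact ⟨σ, max 1 S, hσ0, le_max_left _ _, hσ1,
    fun j => (hS ⟨j, rfl⟩).trans (le_max_right _ _), hσ2⟩

lemma abs_integerForm_le {p : ℕ} (a : Fin p → ℤ) {M : ℝ} (ha : ∀ i, |(a i : ℝ)| ≤ M)
    (u : EuclideanSpace ℝ (Fin p)) : |integerForm a u| ≤ p * (M * ‖u‖) := by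
  change |∑ i, (a i : ℝ) * u i| ≤ _
  calc |∑ i, (a i : ℝ) * u i| ≤ ∑ i, |(a i : ℝ) * u i| := Finset.abs_sum_le_sum_abs _ _
    _ ≤ ∑ _i : Fin p, M * ‖u‖ := Finset.sum_le_sum fun i _ => by
        rw [abs_mul]
        exact mul_le_mul (ha i) (by simpa using PiLp.norm_apply_le u i) (abs_nonneg _)
          ((abs_nonneg _).trans (ha i))
    _ = p * (M * ‖u‖) := by simp

lemma exists_int_integerForm {p : ℕ} (a : Fin p → ℤ) {x : EuclideanSpace ℝ (Fin p)}
    (hx : x ∈ integerPoints p) : ∃ m : ℤ, integerForm a x = m := by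
  obtain ⟨m, hm⟩ := hx
  refine ⟨∑ i, a i * m i, ?_⟩
  change ∑ i, (a i : ℝ) * x i = _
  simp [hm]

/-! ### Integer points near the span: the main estimate -/

/-- The parameters of the main estimate: all scales used lie between `t` and `(1 + β) * t`,
consecutive ones differ by a factor at least `1 + δ`, and `η` bounds the relative errors. -/
lemma exists_scale_parameters (N : ℕ) {σ S ε : ℝ} (hσ : 0 < σ) (hS1 : 1 ≤ S) (hε : 0 < ε) :
    ∃ β δ η : ℝ, 0 < β ∧ β ≤ 1 ∧ S * β ≤ ε / 16 ∧ 0 < δ ∧ (1 + δ) ^ N ≤ 1 + β ∧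
      0 < η ∧ η ≤ δ ∧ 8 * η * (1 + δ) ≤ σ * δ ∧ η ≤ ε / 16 := by
  obtain ⟨β, hβ0, hβ1, hβε⟩ : ∃ β : ℝ, 0 < β ∧ β ≤ 1 ∧ S * β ≤ ε / 16 := by
    refine ⟨min 1 (ε / (16 * S)), lt_min one_pos (by positivity), min_le_left _ _, ?_⟩
    calc S * min 1 (ε / (16 * S)) ≤ S * (ε / (16 * S)) := by
          gcongr
          exact min_le_right _ _
      _ = ε / 16 := by field_simp
  obtain ⟨δ, hδ, hδβ⟩ : ∃ δ : ℝ, 0 < δ ∧ (1 + δ) ^ (N) ≤ 1 + β := by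
    have h : ContinuousAt (fun δ : ℝ => (1 + δ) ^ (N)) 0 := by fun_prop
    have h' : ∀ᶠ δ : ℝ in nhdsWithin 0 (Set.Ioi 0), (1 + δ) ^ (N) ≤ 1 + β :=
      nhdsWithin_le_nhds (h.eventually_le_const (by simpa using hβ0))
    obtain ⟨δ, h1, h2⟩ := (h'.and self_mem_nhdsWithin).exists
    exact ⟨δ, h2, h1⟩
  obtain ⟨η, hη, hηδ, hησ, hηε⟩ :
      ∃ η : ℝ, 0 < η ∧ η ≤ δ ∧ 8 * η * (1 + δ) ≤ σ * δ ∧ η ≤ ε / 16 := by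
    refine ⟨min δ (min (σ * δ / (8 * (1 + δ))) (ε / 16)), by positivity, min_le_left _ _, ?_,
      (min_le_right _ _).trans (min_le_right _ _)⟩
    have : min δ (min (σ * δ / (8 * (1 + δ))) (ε / 16)) ≤ σ * δ / (8 * (1 + δ)) :=
      (min_le_right _ _).trans (min_le_left _ _)
    rw [le_div_iff₀ (by positivity)] at this
    linarith
  exact ⟨β, δ, η, hβ0, hβ1, hβε, hδ, hδβ, hη, hηδ, hησ, hηε⟩

/-- The exponent in the bound for the value of a form at the error vector `u`. -/
lemma error_exponent_le {η β ε s t y : ℝ} (hη : 0 < η) (hβ0 : 0 < β) (hβ1 : β ≤ 1)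
    (hβε : β ≤ ε / 16) (hηε : η ≤ ε / 16) (hs : s ≤ (1 + β) * t) (hty : t ≤ y) (hy : 0 ≤ y) :
    (1 + η) * s + -(1 + ε) * y ≤ -(ε / 2 * y) := by
  have h1 : (1 + η) * s ≤ (1 + η) * ((1 + β) * y) := by
    gcongr
    exact hs.trans (by gcongr)
  have h2 : η * β ≤ ε / 16 := by nlinarith
  have h3 : (1 + η) * (1 + β) ≤ 1 + ε / 2 := by nlinarith
  nlinarith [mul_le_mul_of_nonneg_right h3 hy]

/-- The exponent in the upper bound for each term `c j * L (e j)`. -/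
lemma term_exponent_le {σ δ η τ s t : ℝ} (hη : 0 < η) (hδ : 0 < δ) (hστ : σ ≤ τ)
    (hησ : 8 * η * (1 + δ) ≤ σ * δ) (ht : 0 ≤ t) (hs : (1 + δ) * t ≤ s) :
    τ * t + (-(τ * s) + η * s) ≤ -(σ * δ / 2 * t) := by
  have h0 : σ * δ ≤ τ * δ := mul_le_mul_of_nonneg_right hστ hδ.le
  have h1 : η ≤ τ := by nlinarith
  have h2 : (τ - η) * ((1 + δ) * t) ≤ (τ - η) * s :=
    mul_le_mul_of_nonneg_left hs (by linarith)
  have h3 : σ * δ / 2 ≤ τ * δ - η * (1 + δ) := by nlinarith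
  nlinarith [mul_le_mul_of_nonneg_right h3 ht]

/-- The exponent in the lower bound for a term with coefficient of maximal relative size. -/
lemma le_main_exponent {η β ε S τ s t y K : ℝ} (hη : 0 < η) (hβ0 : 0 < β) (hβ1 : β ≤ 1)
    (hτ : 0 < τ) (hτS : τ ≤ S) (hε : 0 < ε)
    (hβε : S * β ≤ ε / 16) (hηε : η ≤ ε / 16) (hs : s ≤ (1 + β) * t) (ht : 0 ≤ t)
    (hty : t ≤ y) : -K - ε / 4 * y ≤ τ * t - K + (-(τ * s) - η * s) := by
  have g1 : (τ + η) * s ≤ (τ + η) * ((1 + β) * t) :=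
    mul_le_mul_of_nonneg_left hs (by linarith)
  have g2 : τ * β ≤ ε / 16 := (mul_le_mul_of_nonneg_right hτS hβ0.le).trans hβε
  have g3 : η * β ≤ ε / 16 := by nlinarith
  have g4 : (τ * β + η + η * β) * t ≤ ε / 4 * y :=
    mul_le_mul (by linarith) hty ht (by positivity)
  linarith

lemma exp_half_lt {K ε y r : ℝ} (h : r * Real.exp (-(ε / 4 * y)) < Real.exp (-K) / 2) :
    2 * (r * Real.exp (-(ε / 2 * y))) < Real.exp (-K - ε / 4 * y) := by
  have h6 : Real.exp (-(ε / 2 * y)) = Real.exp (-(ε / 4 * y)) * Real.exp (-(ε / 4 * y)) := by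
    rw [← Real.exp_add]
    ring_nf
  have h7 : Real.exp (-K - ε / 4 * y) = Real.exp (-K) * Real.exp (-(ε / 4 * y)) := by
    rw [← Real.exp_add]
    ring_nf
  rw [h6, h7]
  nlinarith [Real.exp_pos (-(ε / 4 * y))]

/-- A vector close to a combination of the `e j` with coefficients of controlled size cannot be an
integer point, unless all the coefficients are small. -/
lemma HasFormsAtAllScales.eventually_notMem_integerPoints {k p : ℕ}
    {e : Fin k → EuclideanSpace ℝ (Fin p)} {τ : Fin k → ℝ} (H : HasFormsAtAllScales e τ)
    (hτ : ∀ j, 0 < τ j) (hinj : Function.Injective τ) {ε b : ℝ} (hε : 0 < ε) (hb : 0 < b) :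
    ∀ᶠ y : ℝ in atTop, ∀ (c : Fin k → ℝ) (u : EuclideanSpace ℝ (Fin p)),
      (∀ j, |c j| ≤ Real.exp (τ j * y)) → (∃ j, b ≤ |c j|) →
      ‖u‖ ≤ Real.exp (-(1 + ε) * y) → ∑ j, c j • e j + u ∉ integerPoints p := by
  obtain ⟨σ, S, hσ, hS1, hστ, hτS, hσd⟩ := exists_exponent_bounds τ hτ hinj
  obtain ⟨β, δ, η, hβ0, hβ1, hβε, hδ, hδβ, hη, hηδ, hησ, hηε⟩ :=
    exists_scale_parameters (2 * (k * k) + 2) hσ hS1 hε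
  have hβε' : β ≤ ε / 16 := (le_mul_of_one_le_left hβ0.le hS1).trans hβε
  have hexp : ∀ r : ℝ, 0 < r → Tendsto (fun t : ℝ => Real.exp (-(r * t))) atTop (nhds 0) :=
    fun r hr => Real.tendsto_exp_neg_atTop_nhds_zero.comp (tendsto_id.const_mul_atTop hr)
  have hsmall : ∀ᶠ t : ℝ in atTop, (k : ℝ) * Real.exp (-(σ * δ / 2 * t)) < 1 / 2 := by
    have := (hexp (σ * δ / 2) (by positivity)).const_mul (k : ℝ)
    rw [mul_zero] at this
    exact this.eventually_lt_const (by norm_num)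
  have hsep : ∀ᶠ t : ℝ in atTop, 4 * Real.log (2 * k) * (1 + δ) < σ * δ * t :=
    (tendsto_id.const_mul_atTop (by positivity)).eventually_gt_atTop _
  obtain ⟨t₀, ht₀⟩ := eventually_atTop.1
    (((H η hη).and (hsmall.and hsep)).and (eventually_ge_atTop (1 : ℝ)))
  have ht₀1 : (1 : ℝ) ≤ t₀ := (ht₀ t₀ le_rfl).2
  obtain ⟨K, hK⟩ := exists_balancing_scale τ hτ hτS (by linarith : 0 < t₀) hb
  have hy1 : ∀ᶠ y : ℝ in atTop, (p : ℝ) * Real.exp (-(ε / 2 * y)) < 1 / 2 := by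
    have := (hexp (ε / 2) (by positivity)).const_mul (p : ℝ)
    rw [mul_zero] at this
    exact this.eventually_lt_const (by norm_num)
  have hy2 : ∀ᶠ y : ℝ in atTop,
      (p : ℝ) * Real.exp (-(ε / 4 * y)) < Real.exp (-K) / 2 := by
    have := (hexp (ε / 4) (by positivity)).const_mul (p : ℝ)
    rw [mul_zero] at this
    exact this.eventually_lt_const (by positivity)
  filter_upwards [hy1, hy2, eventually_ge_atTop t₀] with y hy1 hy2 hy0 c u hc hcb hu hmem
  obtain ⟨t, ht0, hty, hct, m, hm⟩ := hK c y hy0 hc hcb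
  have htpos : 0 < t := by linarith
  have hk : (0 : ℝ) < k := by exact_mod_cast m.pos
  -- scales `(1 + δ) ^ (2 i + 1) * t`, one more than there are pairs of indices
  have hscale : ∀ i : Fin (k * k + 1), t ≤ (1 + δ) ^ (2 * (i : ℕ) + 1) * t := fun i =>
    le_mul_of_one_le_left htpos.le (one_le_pow₀ (by linarith))
  choose a s hs1 hs2 hs3 hs4 using fun i : Fin (k * k + 1) =>
    (ht₀ _ (ht0.trans (hscale i))).1.1
  have hs2' : ∀ i, s i ≤ (1 + δ) ^ (2 * (i : ℕ) + 2) * t := fun i => by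
    refine (hs2 i).trans ?_
    calc (1 + η) * ((1 + δ) ^ (2 * (i : ℕ) + 1) * t)
        ≤ (1 + δ) * ((1 + δ) ^ (2 * (i : ℕ) + 1) * t) := by gcongr
      _ = (1 + δ) ^ (2 * (i : ℕ) + 2) * t := by ring
  have hslow : ∀ i, (1 + δ) * t ≤ s i := fun i => by
    refine le_trans ?_ (hs1 i)
    gcongr
    exact le_self_pow₀ (by linarith) (by omega)
  have hshigh : ∀ i, s i ≤ (1 + β) * t := fun i => by
    refine (hs2' i).trans ?_
    gcongr
    refine le_trans (pow_le_pow_right₀ (by linarith) ?_) hδβ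
    have := i.is_le
    omega
  have hspos : ∀ i, 0 < s i := fun i => by nlinarith [hslow i]
  have hssep : ∀ i i', i < i' → (1 + δ) * s i ≤ s i' := fun i i' hii => by
    refine le_trans ?_ (hs1 i')
    calc (1 + δ) * s i ≤ (1 + δ) * ((1 + δ) ^ (2 * (i : ℕ) + 2) * t) := by
          gcongr
          exact hs2' i
      _ = (1 + δ) ^ (2 * (i : ℕ) + 3) * t := by ring
      _ ≤ (1 + δ) ^ (2 * (i' : ℕ) + 1) * t := by
          refine mul_le_mul_of_nonneg_right (pow_le_pow_right₀ (by linarith) ?_) htpos.le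
          have : (i : ℕ) < i' := hii
          omega
  have hLu : ∀ i, |integerForm (a i) u| ≤ p * Real.exp (-(ε / 2 * y)) := fun i => by
    refine (abs_integerForm_le (a i) (hs4 i) u).trans ?_
    gcongr
    calc Real.exp ((1 + η) * s i) * ‖u‖
        ≤ Real.exp ((1 + η) * s i) * Real.exp (-(1 + ε) * y) := by gcongr
      _ = Real.exp ((1 + η) * s i + -(1 + ε) * y) := (Real.exp_add _ _).symm
      _ ≤ Real.exp (-(ε / 2 * y)) := by
          exact Real.exp_le_exp.2 (error_exponent_le hη hβ0 hβ1 hβε' hηε (hshigh i) hty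
            (htpos.le.trans hty))
  have hlogle : ∀ i j, Real.log |integerForm (a i) (e j)| ≤ -(τ j * s i) + η * s i := fun i j => by
    linarith [(abs_le.1 (hs3 i j).2).2]
  have hlogge : ∀ i j, -(τ j * s i) - η * s i ≤ Real.log |integerForm (a i) (e j)| := fun i j => by
    linarith [(abs_le.1 (hs3 i j).2).1]
  have hterm : ∀ i j, |c j * integerForm (a i) (e j)| ≤ Real.exp (-(σ * δ / 2 * t)) := fun i j => by
    have hL : |integerForm (a i) (e j)| ≤ Real.exp (-(τ j * s i) + η * s i) :=
      (Real.log_le_iff_le_exp (abs_pos.2 (hs3 i j).1)).1 (hlogle i j)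
    rw [abs_mul]
    calc |c j| * |integerForm (a i) (e j)|
        ≤ Real.exp (τ j * t) * Real.exp (-(τ j * s i) + η * s i) := by
          gcongr
          exact hct j
      _ = Real.exp (τ j * t + (-(τ j * s i) + η * s i)) := (Real.exp_add _ _).symm
      _ ≤ Real.exp (-(σ * δ / 2 * t)) := by
          exact Real.exp_le_exp.2 (term_exponent_le hη hδ (hστ j) hησ htpos.le (hslow i))
  have hsum : ∀ i, integerForm (a i) (∑ j, c j • e j + u)
      = ∑ j, c j * integerForm (a i) (e j) + integerForm (a i) u := fun i => by
    simp [map_sum]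
  -- an integer of absolute value less than `1` vanishes
  have hzero : ∀ i, ∑ j, c j * integerForm (a i) (e j) = -integerForm (a i) u := fun i => by
    obtain ⟨z, hz⟩ := exists_int_integerForm (a i) hmem
    rw [hsum] at hz
    have h1 : |∑ j, c j * integerForm (a i) (e j)| ≤ k * Real.exp (-(σ * δ / 2 * t)) := by
      refine (Finset.abs_sum_le_sum_abs _ _).trans
        ((Finset.sum_le_sum fun j _ => hterm i j).trans (by simp))
    have h2 := (ht₀ t ht0).1.2.1
    have h3 : |(z : ℝ)| < 1 := by
      rw [← hz]
      linarith [abs_add_le (∑ j, c j * integerForm (a i) (e j)) (integerForm (a i) u), hLu i]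
    have h4 : z = 0 := by
      rw [← Int.abs_lt_one_iff]
      exact_mod_cast h3
    rw [h4, Int.cast_zero] at hz
    linarith
  have hm0 : c m ≠ 0 := by
    intro h
    rw [h, abs_zero] at hm
    exact (Real.exp_pos _).not_ge hm
  -- no scale has a dominant term, so each has two comparable ones
  have hbad : ∀ i, ∃ jj : Fin k × Fin k, jj.1 ≠ jj.2 ∧ c jj.1 ≠ 0 ∧ c jj.2 ≠ 0 ∧
      |Real.log |c jj.1| - Real.log |c jj.2| - (τ jj.1 - τ jj.2) * s i|
        ≤ Real.log (2 * k) + 2 * (η * s i) := fun i => by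
    rcases half_abs_le_abs_sum_or_exists_comparable (fun j => c j * integerForm (a i) (e j))
      ⟨m, mul_ne_zero hm0 (hs3 i m).1⟩ with h | ⟨j, j', hne, h1, h2, h3, h4⟩
    · exfalso
      have h1 := h m
      rw [hzero i, abs_neg, abs_mul] at h1
      have h2 : Real.exp (-(τ m * s i) - η * s i) ≤ |integerForm (a i) (e m)| :=
        (Real.le_log_iff_exp_le (abs_pos.2 (hs3 i m).1)).1 (hlogge i m)
      have h3 : Real.exp (-K - ε / 4 * y) ≤ |c m| * |integerForm (a i) (e m)| := by
        calc Real.exp (-K - ε / 4 * y)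
            ≤ Real.exp (τ m * t - K + (-(τ m * s i) - η * s i)) := by
              exact Real.exp_le_exp.2 (le_main_exponent hη hβ0 hβ1 (hτ m) (hτS m) hε hβε hηε
                (hshigh i) htpos.le hty)
          _ = Real.exp (τ m * t - K) * Real.exp (-(τ m * s i) - η * s i) := Real.exp_add _ _
          _ ≤ |c m| * |integerForm (a i) (e m)| := by gcongr
      linarith [hLu i, exp_half_lt hy2]
    · exact ⟨(j, j'), hne, left_ne_zero_of_mul h1, left_ne_zero_of_mul h2,
        log_ratio_near (left_ne_zero_of_mul h1) (left_ne_zero_of_mul h2) (hs3 i j).1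
          (hs3 i j').1 h3 h4 (by positivity) (hs3 i j).2 (hs3 i j').2⟩
  choose jj hne _ _ hnear using hbad
  obtain ⟨i, i', hii, hjj⟩ := Fintype.exists_ne_map_eq_of_card_lt jj (by simp)
  wlog hlt : i < i' generalizing i i'
  · exact this i' i hii.symm hjj.symm (lt_of_le_of_ne (not_lt.1 hlt) hii.symm)
  have h' := hnear i'
  rw [← hjj] at h'
  refine not_comparable_twice (hσd _ _ (hne i)) (hssep i i' hlt) hδ hησ (hspos i).le hη ?_
    (hnear i) h'
  have hti' : t₀ ≤ s i' := by nlinarith [hslow i']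
  exact (ht₀ _ hti').1.2.2

/-! ### From oscillating sequences to forms at all scales -/

/-- Almost periodicity: if the cosines are all nonzero at one integer, then they are bounded away
from `0` on a set of integers with bounded gaps. -/
lemma exists_bounded_gaps_le_abs_cos {k : ℕ} (ω φ : Fin k → ℝ) {n₀ : ℤ}
    (hn₀ : ∀ j, Real.cos (n₀ * ω j + φ j) ≠ 0) :
    ∃ (c : ℝ) (M : ℕ), 0 < c ∧ ∀ N : ℕ, ∃ n : ℕ, N ≤ n ∧ n ≤ N + M ∧
      ∀ j, c ≤ |Real.cos (n * ω j + φ j)| := by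
  obtain ⟨c, hc, hc'⟩ : ∃ c : ℝ, 0 < c ∧ ∀ j, 2 * c ≤ |Real.cos (n₀ * ω j + φ j)| := by
    have h : ∀ᶠ c : ℝ in nhdsWithin 0 (Set.Ioi 0), ∀ j, 2 * c ≤ |Real.cos (n₀ * ω j + φ j)| := by
      refine eventually_all.2 fun j => nhdsWithin_le_nhds ?_
      have : ContinuousAt (fun c : ℝ => 2 * c) 0 := by fun_prop
      exact this.eventually_le_const (by simpa using hn₀ j)
    obtain ⟨c, h1, h2⟩ := (h.and self_mem_nhdsWithin).exists
    exact ⟨c, h2, h1⟩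
  let z : ℤ → Fin k → ℂ := fun n j => Complex.exp ((n * ω j : ℝ) * Complex.I)
  have hz : TotallyBounded (Set.range z) := by
    refine TotallyBounded.subset ?_
      (isCompact_closedBall (0 : Fin k → ℂ) 1).totallyBounded
    rintro _ ⟨n, rfl⟩
    rw [mem_closedBall_zero_iff, pi_norm_le_iff_of_nonneg zero_le_one]
    exact fun j => (Complex.norm_exp_ofReal_mul_I _).le
  obtain ⟨t, htz, htfin, ht⟩ := Metric.finite_approx_of_totallyBounded hz c hc
  choose! g hg using fun y (hy : y ∈ t) => htz hy
  obtain ⟨M, hM⟩ : ∃ M : ℕ, ∀ y ∈ t, (g y).natAbs ≤ M := by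
    obtain ⟨M, hM⟩ := (htfin.image fun y => (g y).natAbs).bddAbove
    exact ⟨M, fun y hy => hM ⟨y, hy, rfl⟩⟩
  refine ⟨c, 2 * M, hc, fun N => ?_⟩
  -- `z (N + M - n₀)` is near some `z m` with `|m| ≤ M`, so a shift of `n₀` by
  -- `N + M - n₀ - m` hardly changes the cosines and lands in `[N, N + 2 * M]`
  obtain ⟨y, hy, hyN⟩ : ∃ y ∈ t, z (N + M - n₀) ∈ Metric.ball y c := by
    simpa using ht ⟨(N + M - n₀ : ℤ), rfl⟩
  have hgy := hM y hy
  refine ⟨(N + M - g y).toNat, by omega, by omega, fun j => ?_⟩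
  have hcast : (((N + M - g y).toNat : ℕ) : ℝ) = N + M - g y := by
    have : ((N + M - g y).toNat : ℤ) = N + M - g y := Int.toNat_of_nonneg (by omega)
    exact_mod_cast congrArg (Int.cast : ℤ → ℝ) this
  rw [hcast]
  have hd : ‖z (N + M - n₀) j - z (g y) j‖ ≤ c := by
    have h1 : dist (z (N + M - n₀)) (z (g y)) < c := by
      rw [hg y hy]
      exact hyN
    rw [← dist_eq_norm]
    exact (dist_le_pi_dist _ _ j).trans h1.le
  have hre : |Real.cos ((N + M - g y) * ω j + φ j) - Real.cos (n₀ * ω j + φ j)| ≤ c := by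
    set r : ℝ := (n₀ - g y) * ω j + φ j with hr
    calc |Real.cos ((N + M - g y) * ω j + φ j) - Real.cos (n₀ * ω j + φ j)|
        = |(Complex.exp (r * Complex.I) * (z (N + M - n₀) j - z (g y) j)).re| := by
          congr 1
          simp only [z]
          rw [mul_sub, ← Complex.exp_add, ← Complex.exp_add, ← add_mul, ← add_mul,
            ← Complex.ofReal_add, ← Complex.ofReal_add, Complex.sub_re,
            Complex.exp_ofReal_mul_I_re, Complex.exp_ofReal_mul_I_re, hr]
          push_cast
          congr 2 <;> ring
      _ ≤ ‖Complex.exp (r * Complex.I) * (z (N + M - n₀) j - z (g y) j)‖ :=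
          Complex.abs_re_le_norm _
      _ ≤ c := by rwa [norm_mul, Complex.norm_exp_ofReal_mul_I, one_mul]
  have := abs_sub_abs_le_abs_sub (Real.cos (n₀ * ω j + φ j))
    (Real.cos ((N + M - g y) * ω j + φ j))
  rw [abs_sub_comm] at this
  linarith [hc' j]

/-- If `q (n + 1) / q n` tends to `1`, then a window of any fixed length can be placed so that `q`
is nearly constant on it, near any prescribed large value. -/
lemma eventually_exists_window {q : ℕ → ℝ} (hmono : MonotoneOn q (Set.Ici 1))
    (hlim : Tendsto q atTop atTop)
    (hgrow : ∀ θ : ℝ, 0 < θ → ∀ᶠ n in atTop, q (n + 1) ≤ (1 + θ) * q n)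
    {P : ℕ → Prop} (hP : ∀ᶠ n in atTop, P n) (M : ℕ) {η : ℝ} (hη : 0 < η) :
    ∀ᶠ t : ℝ in atTop, ∃ N : ℕ, ∀ n, N ≤ n → n ≤ N + M → t ≤ q n ∧ q n ≤ (1 + η) * t ∧ P n := by
  obtain ⟨θ, hθ, hθη⟩ : ∃ θ : ℝ, 0 < θ ∧ (1 + θ) ^ (M + 1) ≤ 1 + η := by
    have h : ContinuousAt (fun θ : ℝ => (1 + θ) ^ (M + 1)) 0 := by fun_prop
    have h' : ∀ᶠ θ : ℝ in nhdsWithin 0 (Set.Ioi 0), (1 + θ) ^ (M + 1) ≤ 1 + η :=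
      nhdsWithin_le_nhds (h.eventually_le_const (by simpa using hη))
    obtain ⟨θ, h1, h2⟩ := (h'.and self_mem_nhdsWithin).exists
    exact ⟨θ, h2, h1⟩
  obtain ⟨N₁, hN₁⟩ := eventually_atTop.1 (((hgrow θ hθ).and hP).and
    ((hlim.eventually_ge_atTop 0).and (eventually_ge_atTop 1)))
  filter_upwards [eventually_gt_atTop (q N₁)] with t ht
  have hex : ∃ N, N₁ ≤ N ∧ t ≤ q N :=
    ((eventually_ge_atTop N₁).and (hlim.eventually_ge_atTop t)).exists
  classical
  obtain ⟨hN, htN⟩ := Nat.find_spec hex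
  have hmin : ∀ m < Nat.find hex, ¬(N₁ ≤ m ∧ t ≤ q m) := fun m hm => Nat.find_min hex hm
  generalize Nat.find hex = N at hN htN hmin
  have hlt : N₁ < N := by
    refine lt_of_le_of_ne hN ?_
    rintro rfl
    linarith
  obtain ⟨m, rfl⟩ : ∃ m, N = m + 1 := ⟨N - 1, by omega⟩
  have hm : N₁ ≤ m := by omega
  have hqm : q m < t := not_le.1 fun h => hmin m (Nat.lt_succ_self m) ⟨hm, h⟩
  have hiter : ∀ i, q (m + i) ≤ (1 + θ) ^ i * q m := fun i => by
    induction i with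
    | zero => simp
    | succ i ih =>
      calc q (m + (i + 1)) ≤ (1 + θ) * q (m + i) := (hN₁ (m + i) (by omega)).1.1
        _ ≤ (1 + θ) * ((1 + θ) ^ i * q m) := by gcongr
        _ = (1 + θ) ^ (i + 1) * q m := by ring
  refine ⟨m + 1, fun n hn1 hn2 => ⟨htN.trans (hmono ?_ ?_ hn1), ?_, (hN₁ n (by omega)).1.2⟩⟩
  · exact (hN₁ _ hN).2.2
  · exact (hN₁ n (by omega)).2.2
  · obtain ⟨i, rfl⟩ : ∃ i, n = m + i := ⟨n - m, by omega⟩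
    have hq0 := (hN₁ m hm).2.1
    have ht0 : 0 ≤ t := hq0.trans hqm.le
    calc q (m + i) ≤ (1 + θ) ^ i * q m := hiter i
      _ ≤ (1 + θ) ^ (M + 1) * t := by
          refine mul_le_mul (pow_le_pow_right₀ (by linarith) (by omega)) hqm.le hq0 (by positivity)
      _ ≤ (1 + η) * t := by gcongr

lemma eventually_log_le_of_rpow {Q : ℕ → ℕ} (hQ_lim : Tendsto Q atTop atTop) {c : ℕ → ℝ}
    (hc : Tendsto c atTop (nhds 0))
    (hQc : ∀ᶠ n in atTop, (Q (n + 1) : ℝ) = (Q n : ℝ) ^ (1 + c n)) {θ : ℝ} (hθ : 0 < θ) :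
    ∀ᶠ n in atTop, Real.log (Q (n + 1)) ≤ (1 + θ) * Real.log (Q n) := by
  filter_upwards [hQc, hc.eventually_le_const hθ, hQ_lim.eventually_ge_atTop 1] with n h1 h2 h3
  have hQ : (1 : ℝ) ≤ Q n := by exact_mod_cast h3
  rw [h1, Real.log_rpow (by linarith)]
  gcongr

/-- Where the oscillating factor `C n` is not small, a quantity of size
`exp (-(τ + o(1)) * q n) * |C n + o(1)|` has size `exp (-(τ + o(1)) * q n)`. -/
lemma eventually_log_form_near {q x : ℕ → ℝ} {τ c η : ℝ} {C a b : ℕ → ℝ}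
    (hq : Tendsto q atTop atTop) (ha : Tendsto a atTop (nhds 0)) (hb : Tendsto b atTop (nhds 0))
    (hx : ∀ᶠ n in atTop, |x n| = Real.exp (q n * (-τ + a n)) * |C n + b n|)
    (hC : ∀ n, |C n| ≤ 1) (hc : 0 < c) (hη : 0 < η) :
    ∀ᶠ n in atTop, c ≤ |C n| → x n ≠ 0 ∧ |Real.log |x n| + τ * q n| ≤ η * q n := by
  have hb' : Tendsto (fun n => |b n|) atTop (nhds 0) := by simpa using hb.abs
  have ha' : Tendsto (fun n => |a n|) atTop (nhds 0) := by simpa using ha.abs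
  filter_upwards [hx, ha'.eventually_le_const (half_pos hη),
    hb'.eventually_le_const (half_pos hc), hb'.eventually_le_const zero_lt_one,
    hq.eventually_ge_atTop 0,
    (hq.const_mul_atTop (half_pos hη)).eventually_ge_atTop (Real.log 2),
    (hq.const_mul_atTop (half_pos hη)).eventually_ge_atTop (-Real.log (c / 2))]
    with n h1 h2 h3 h4 h5 h6 h7 hcn
  have hlow : c / 2 ≤ |C n + b n| := by
    have := abs_sub_abs_le_abs_sub (C n) (-b n)
    rw [abs_neg, sub_neg_eq_add] at this
    linarith
  have hhigh : |C n + b n| ≤ 2 := by linarith [abs_add_le (C n) (b n), hC n]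
  have hpos : 0 < |C n + b n| := by linarith
  refine ⟨abs_pos.1 (by rw [h1]; positivity), ?_⟩
  have g1 := Real.log_le_log (by positivity) hlow
  have g2 := Real.log_le_log hpos hhigh
  rw [h1, Real.log_mul (Real.exp_pos _).ne' hpos.ne', Real.log_exp]
  have g3 : |q n * a n| ≤ η / 2 * q n := by
    rw [abs_mul, abs_of_nonneg h5, mul_comm]
    gcongr
  rw [abs_le] at g3 ⊢
  constructor <;> nlinarith [g3.1, g3.2]

lemma hasFormsAtAllScales_of_oscillating {k p : ℕ} {e : Fin k → EuclideanSpace ℝ (Fin p)}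
    {τ ω φ : Fin k → ℝ} {n₀ : ℤ} (hn₀ : ∀ j, Real.cos (n₀ * ω j + φ j) ≠ 0)
    {Q : ℕ → ℕ} (hQ_pos : ∀ n, 1 ≤ n → 0 < Q n) (hQ_mono : MonotoneOn Q (Set.Ici 1))
    (hQ_lim : Tendsto Q atTop atTop) {c : ℕ → ℝ} (hc : Tendsto c atTop (nhds 0))
    (hQc : ∀ᶠ n in atTop, (Q (n + 1) : ℝ) = (Q n : ℝ) ^ (1 + c n))
    (l : ℕ → Fin p → ℤ)
    (hl_small : ∀ j, ∃ a b : ℕ → ℝ, Tendsto a atTop (nhds 0) ∧ Tendsto b atTop (nhds 0) ∧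
      ∀ᶠ n in atTop, |integerForm (l n) (e j)| =
        (Q n : ℝ) ^ (-τ j + a n) * |Real.cos (n * ω j + φ j) + b n|)
    (hl_coeff : ∃ d : ℕ → ℝ, Tendsto d atTop (nhds 0) ∧
      ∀ᶠ n in atTop, ∀ i, |(l n i : ℝ)| ≤ (Q n : ℝ) ^ (1 + d n)) :
    HasFormsAtAllScales e τ := by
  intro η hη
  obtain ⟨c₀, M, hc₀, hM⟩ := exists_bounded_gaps_le_abs_cos ω φ hn₀
  have hpos : ∀ᶠ n in atTop, (0 : ℝ) < Q n := by
    filter_upwards [hQ_lim.eventually_gt_atTop 0] with n hn using by exact_mod_cast hn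
  have hq_lim : Tendsto (fun n => Real.log (Q n)) atTop atTop :=
    Real.tendsto_log_atTop.comp (tendsto_natCast_atTop_atTop.comp hQ_lim)
  have hq_mono : MonotoneOn (fun n => Real.log (Q n)) (Set.Ici 1) := fun m hm n hn hmn =>
    Real.log_le_log (by exact_mod_cast hQ_pos m hm) (by exact_mod_cast hQ_mono hm hn hmn)
  have hsmall : ∀ᶠ n : ℕ in atTop, ∀ j, c₀ ≤ |Real.cos (n * ω j + φ j)| →
      integerForm (l n) (e j) ≠ 0 ∧
        |Real.log |integerForm (l n) (e j)| + τ j * Real.log (Q n)| ≤ η * Real.log (Q n) := by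
    refine eventually_all.2 fun j => ?_
    obtain ⟨a, b, ha, hb, hab⟩ := hl_small j
    refine eventually_log_form_near hq_lim ha hb ?_ (fun n => Real.abs_cos_le_one _) hc₀ hη
    filter_upwards [hab, hpos] with n h1 h2
    rw [h1, Real.rpow_def_of_pos h2]
  have hcoeff : ∀ᶠ n in atTop, ∀ i, |(l n i : ℝ)| ≤ Real.exp ((1 + η) * Real.log (Q n)) := by
    obtain ⟨d, hd, hdl⟩ := hl_coeff
    filter_upwards [hdl, hd.eventually_le_const hη, hpos, hq_lim.eventually_ge_atTop 0]
      with n h1 h2 h3 h4 i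
    refine (h1 i).trans ?_
    rw [Real.rpow_def_of_pos h3, mul_comm]
    gcongr
  filter_upwards [eventually_exists_window hq_mono hq_lim
    (fun θ hθ => eventually_log_le_of_rpow hQ_lim hc hQc hθ) (hsmall.and hcoeff) M hη]
    with t ⟨N, hN⟩
  obtain ⟨n, hn1, hn2, hn3⟩ := hM N
  obtain ⟨h1, h2, h3, h4⟩ := hN n hn1 hn2
  exact ⟨l n, Real.log (Q n), h1, h2, fun j => h3 j (hn3 j), h4⟩

/-! ### Geometry of numbers -/

/-- **Minkowski's theorem** for boxes, with an unspecified constant. -/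
lemma exists_const_forall_exists_mem_span_int_abs_le {ι κ : Type*} [Fintype ι] [Fintype κ]
    (b : Module.Basis κ ℝ (ι → ℝ)) :
    ∃ D : ℝ, ∀ r : ι → ℝ, (∀ i, 0 ≤ r i) → D < ∏ i, r i →
      ∃ x ∈ Submodule.span ℤ (Set.range b), x ≠ 0 ∧ ∀ i, |x i| ≤ r i := by
  have hfin : MeasureTheory.volume (ZSpan.fundamentalDomain b) ≠ ⊤ :=
    (ZSpan.fundamentalDomain_isBounded b).measure_lt_top.ne
  refine ⟨(MeasureTheory.volume (ZSpan.fundamentalDomain b)).toReal, fun r hr hD => ?_⟩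
  have hvol : MeasureTheory.volume (ZSpan.fundamentalDomain b) * 2 ^ Module.finrank ℝ (ι → ℝ)
      < MeasureTheory.volume (Set.Icc (-r) r) := by
    have h : ∏ i, ENNReal.ofReal (r i - (-r) i) =
        ENNReal.ofReal (∏ i, r i) * 2 ^ Module.finrank ℝ (ι → ℝ) := by
      rw [ENNReal.ofReal_prod_of_nonneg fun i _ => hr i, Module.finrank_fintype_fun_eq_card,
        ← Finset.card_univ, ← Finset.prod_const, ← Finset.prod_mul_distrib]
      refine Finset.prod_congr rfl fun i _ => ?_
      rw [Pi.neg_apply, sub_neg_eq_add, ← mul_two, ENNReal.ofReal_mul (hr i)]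
      simp
    rw [Real.volume_Icc_pi, h]
    refine ENNReal.mul_lt_mul_left (by simp) (by simp) ?_
    rwa [← ENNReal.ofReal_toReal hfin, ENNReal.ofReal_lt_ofReal_iff_of_nonneg ENNReal.toReal_nonneg]
  have hcount : Countable (Submodule.span ℤ (Set.range b)).toAddSubgroup :=
    inferInstanceAs (Countable (Submodule.span ℤ (Set.range b)))
  obtain ⟨x, hx0, hx⟩ :=
    MeasureTheory.exists_ne_zero_mem_lattice_of_measure_mul_two_pow_lt_measure
      (ZSpan.isAddFundamentalDomain' b MeasureTheory.volume)
      (s := Set.Icc (-r) r) (fun x hx => ⟨neg_le_neg hx.2, by simpa using neg_le_neg hx.1⟩)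
      (convex_Icc _ _) hvol
  exact ⟨x, x.2, by simpa using hx0, fun i => abs_le.2 ⟨hx.1 i, hx.2 i⟩⟩

lemma exists_basis_sum_inl_eq {K V ι : Type*} [Field K] [AddCommGroup V] [Module K V]
    [Module.Finite K V] {v : ι → V} (hv : LinearIndependent K v) :
    ∃ (m : ℕ) (g : Module.Basis (ι ⊕ Fin m) K V), ∀ i, g (Sum.inl i) = v i := by
  obtain ⟨W, hW⟩ := Submodule.exists_isCompl (Submodule.span K (Set.range v))
  refine ⟨Module.finrank K W, ((Module.Basis.span hv).prod (Module.finBasis K W)).map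
    (Submodule.prodEquivOfIsCompl _ _ hW), fun i => ?_⟩
  simp [Module.Basis.span_apply]

lemma one_le_norm_of_mem_integerPoints {p : ℕ} {x : EuclideanSpace ℝ (Fin p)}
    (hx : x ∈ integerPoints p) (h0 : x ≠ 0) : 1 ≤ ‖x‖ := by
  obtain ⟨m, hm⟩ := hx
  obtain ⟨i, hi⟩ : ∃ i, m i ≠ 0 := by
    by_contra! h
    exact h0 (by ext i; simp [hm, h])
  have h1 : (1 : ℝ) ≤ |(m i : ℝ)| := by exact_mod_cast Int.one_le_abs hi
  calc (1 : ℝ) ≤ |(m i : ℝ)| := h1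
    _ = ‖x i‖ := by rw [hm, Real.norm_eq_abs]
    _ ≤ ‖x‖ := PiLp.norm_apply_le x i

/-- The coefficients of a vector of norm at least `1` near the span of `e` are not all small. No
independence of `e` is needed. -/
lemma exists_le_abs_coeff {k : ℕ} {E : Type*} [NormedAddCommGroup E] [NormedSpace ℝ E]
    (e : Fin k → E) : ∃ b : ℝ, 0 < b ∧ ∀ (c : Fin k → ℝ) (u : E), ‖u‖ ≤ 1 / 2 →
      1 ≤ ‖∑ j, c j • e j + u‖ → ∃ j, b ≤ |c j| := by
  have hS : 0 ≤ ∑ j, ‖e j‖ := Finset.sum_nonneg fun _ _ => norm_nonneg _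
  refine ⟨1 / (2 * (∑ j, ‖e j‖ + 1)), by positivity, fun c u hu h1 => ?_⟩
  by_contra! h
  have h2 : ‖∑ j, c j • e j‖ ≤ 1 / (2 * (∑ j, ‖e j‖ + 1)) * ∑ j, ‖e j‖ := by
    rw [Finset.mul_sum]
    refine (norm_sum_le _ _).trans (Finset.sum_le_sum fun j _ => ?_)
    rw [norm_smul, Real.norm_eq_abs]
    gcongr
    exact (h j).le
  have h3 : 1 / (2 * (∑ j, ‖e j‖ + 1)) * ∑ j, ‖e j‖ < 1 / 2 := by
    rw [div_mul_eq_mul_div, div_lt_div_iff₀ (by positivity) two_pos]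
    linarith
  linarith [norm_add_le (∑ j, c j • e j) u]

/-! ### Integer and rational points near the span -/

section
variable {k p : ℕ} {e : Fin k → EuclideanSpace ℝ (Fin p)} {τ : Fin k → ℝ}

/-- The convex body of scale `y` contains no nonzero integer point; the orthogonality of `u` to the
`e j` plays no role. -/
lemma HasFormsAtAllScales.eventually_eq_zero (H : HasFormsAtAllScales e τ) (hτ : ∀ j, 0 < τ j)
    (hinj : Function.Injective τ) {ε : ℝ} (hε : 0 < ε) :
    ∀ᶠ y : ℝ in atTop, ∀ (c : Fin k → ℝ) (u : EuclideanSpace ℝ (Fin p)),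
      (∀ j, |c j| ≤ Real.exp (τ j * y)) → ‖u‖ ≤ Real.exp (-(1 + ε) * y) →
      ∑ j, c j • e j + u ∈ integerPoints p → ∑ j, c j • e j + u = 0 := by
  obtain ⟨b, hb, hbe⟩ := exists_le_abs_coeff e
  filter_upwards [H.eventually_notMem_integerPoints hτ hinj hε hb,
    eventually_ge_atTop (Real.log 2)] with y hy hy2 c u hc hu hmem
  by_contra h0
  refine hy c u hc (hbe c u (hu.trans ?_) (one_le_norm_of_mem_integerPoints hmem h0)) hu hmem
  have hlog : 0 < Real.log 2 := Real.log_pos one_lt_two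
  calc Real.exp (-(1 + ε) * y) ≤ Real.exp (-Real.log 2) := Real.exp_le_exp.2 (by nlinarith)
    _ = 1 / 2 := by rw [Real.exp_neg, Real.exp_log two_pos, one_div]

lemma HasFormsAtAllScales.linearIndependent (H : HasFormsAtAllScales e τ) (hτ : ∀ j, 0 < τ j)
    (hinj : Function.Injective τ) : LinearIndependent ℝ e := by
  rw [Fintype.linearIndependent_iff]
  intro c hc j
  by_contra hj
  have hbound : ∀ᶠ y : ℝ in atTop, ∀ i, |c i| ≤ Real.exp (τ i * y) :=
    eventually_all.2 fun i => (Real.tendsto_exp_atTop.comp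
      (tendsto_id.const_mul_atTop (hτ i))).eventually_ge_atTop _
  obtain ⟨y, h1, h2⟩ := ((H.eventually_notMem_integerPoints hτ hinj one_pos
    (abs_pos.2 hj)).and hbound).exists
  refine h1 c 0 h2 ⟨j, le_rfl⟩ (by simpa using (Real.exp_pos _).le) ?_
  rw [hc, add_zero]
  exact ⟨0, by simp⟩

lemma exists_int_smul_mem_integerPoints {x : EuclideanSpace ℝ (Fin p)}
    (hx : x ∈ rationalPoints p) : ∃ m : ℤ, m ≠ 0 ∧ (m : ℝ) • x ∈ integerPoints p := by
  obtain ⟨r, hr⟩ := hx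
  obtain ⟨m, hm⟩ := IsLocalization.exist_integer_multiples_of_finite (nonZeroDivisors ℤ) r
  refine ⟨m, nonZeroDivisors.ne_zero m.2, ?_⟩
  choose z hz using hm
  refine ⟨z, fun i => ?_⟩
  have : ((z i : ℚ) : ℝ) = ((m : ℤ) • r i : ℚ) := by
    exact_mod_cast hz i
  simpa [hr] using this.symm

lemma HasFormsAtAllScales.disjoint_span_rationalPoints (H : HasFormsAtAllScales e τ)
    (hτ : ∀ j, 0 < τ j) (hinj : Function.Injective τ) :
    Disjoint (Submodule.span ℝ (Set.range e) : Set (EuclideanSpace ℝ (Fin p)))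
      (rationalPoints p \ {0}) := by
  rw [Set.disjoint_left]
  rintro x hx ⟨hxr, hx0⟩
  obtain ⟨m, hm0, hm⟩ := exists_int_smul_mem_integerPoints hxr
  obtain ⟨c, hc⟩ := (Submodule.mem_span_range_iff_exists_fun ℝ).1 (Submodule.smul_mem _ (m : ℝ) hx)
  have hbound : ∀ᶠ y : ℝ in atTop, ∀ i, |c i| ≤ Real.exp (τ i * y) :=
    eventually_all.2 fun i => (Real.tendsto_exp_atTop.comp
      (tendsto_id.const_mul_atTop (hτ i))).eventually_ge_atTop _
  obtain ⟨y, h1, h2⟩ := ((H.eventually_eq_zero hτ hinj one_pos).and hbound).exists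
  have := h1 c 0 h2 (by simpa using (Real.exp_pos _).le) (by rwa [hc, add_zero])
  rw [hc, add_zero, smul_eq_zero] at this
  exact this.elim (by exact_mod_cast hm0) hx0

lemma add_mem_integerPoints {x y : EuclideanSpace ℝ (Fin p)} (hx : x ∈ integerPoints p)
    (hy : y ∈ integerPoints p) : x + y ∈ integerPoints p := by
  obtain ⟨m, hm⟩ := hx
  obtain ⟨n, hn⟩ := hy
  exact ⟨m + n, fun i => by simp [hm, hn]⟩

lemma zsmul_mem_integerPoints (z : ℤ) {x : EuclideanSpace ℝ (Fin p)} (hx : x ∈ integerPoints p) :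
    z • x ∈ integerPoints p := by
  obtain ⟨m, hm⟩ := hx
  exact ⟨z • m, fun i => by simp [hm]⟩

/-- A real subspace spanned by rational points has a basis of integer points. -/
lemma exists_basis_mem_integerPoints {V : Set (EuclideanSpace ℝ (Fin p))}
    (hV : V ⊆ rationalPoints p) :
    ∃ (d : ℕ) (f : Module.Basis (Fin d) ℝ (Submodule.span ℝ V)),
      ∀ i, (f i : EuclideanSpace ℝ (Fin p)) ∈ integerPoints p := by
  obtain ⟨f, hfV, hf, hli⟩ := Submodule.exists_fun_fin_finrank_span_eq ℝ V
  choose m hm0 hm using fun i => exists_int_smul_mem_integerPoints (hV (hfV i))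
  have hb : ∀ i, (((Module.Basis.span hli).map (LinearEquiv.ofEq _ _ hf)) i : _) =
      (⟨f i, Submodule.subset_span (hfV i)⟩ : Submodule.span ℝ V) := fun i => by
    ext1
    simp [Module.Basis.span_apply]
  refine ⟨_, ((Module.Basis.span hli).map (LinearEquiv.ofEq _ _ hf)).isUnitSMul
    (w := fun i => (m i : ℝ)) fun i => (Int.cast_ne_zero.2 (hm0 i)).isUnit, fun i => ?_⟩
  rw [Module.Basis.isUnitSMul_apply, hb]
  exact hm i

/-- The dimension bound for subspaces spanned by rational points. Otherwise Minkowski's theorem, in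
coordinates with respect to a basis extending `e`, yields an integer point that
`HasFormsAtAllScales.eventually_eq_zero` excludes. -/
lemma HasFormsAtAllScales.le_finrank_span (H : HasFormsAtAllScales e τ)
    (hτ : ∀ j, 0 < τ j) (hinj : Function.Injective τ) {V : Set (EuclideanSpace ℝ (Fin p))}
    (hV : V ⊆ rationalPoints p) (heV : ∀ j, e j ∈ Submodule.span ℝ V) :
    (k : ℝ) + ∑ j, τ j ≤ Module.finrank ℝ (Submodule.span ℝ V) := by
  obtain ⟨d, f, hf⟩ := exists_basis_mem_integerPoints hV
  have hli : LinearIndependent ℝ (fun j => (⟨e j, heV j⟩ : Submodule.span ℝ V)) :=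
    LinearIndependent.of_comp (Submodule.subtype _) (H.linearIndependent hτ hinj)
  obtain ⟨m, g, hg⟩ := exists_basis_sum_inl_eq hli
  have hdim : Module.finrank ℝ (Submodule.span ℝ V) = k + m := by
    simp [Module.finrank_eq_card_basis g]
  rw [hdim]
  push_cast
  by_contra! hlt
  -- the strict inequality leaves room for an exponent slightly larger than `1`, and twice the
  -- excess absorbs the norms of the basis vectors
  obtain ⟨ε, hε, hεm⟩ : ∃ ε : ℝ, 0 < ε ∧ (1 + 2 * ε) * m < ∑ j, τ j := by
    have h : ContinuousAt (fun ε : ℝ => (1 + 2 * ε) * m) 0 := by fun_prop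
    have h' : ∀ᶠ ε : ℝ in nhdsWithin 0 (Set.Ioi 0), (1 + 2 * ε) * m < ∑ j, τ j :=
      nhdsWithin_le_nhds (h.eventually_lt_const (by simpa using by linarith))
    obtain ⟨ε, h1, h2⟩ := (h'.and self_mem_nhdsWithin).exists
    exact ⟨ε, h2, h1⟩
  obtain ⟨D, hD⟩ := exists_const_forall_exists_mem_span_int_abs_le (f.map g.equivFun)
  let r : ℝ → Fin k ⊕ Fin m → ℝ := fun y =>
    Sum.elim (fun j => Real.exp (τ j * y)) (fun _ => Real.exp (-(1 + 2 * ε) * y))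
  have hprod : ∀ y, ∏ i, r y i = Real.exp ((∑ j, τ j - (1 + 2 * ε) * m) * y) := fun y => by
    simp only [r, Fintype.prod_sum_type, Sum.elim_inl, Sum.elim_inr, ← Real.exp_sum,
      ← Real.exp_add, ← Finset.sum_mul, Finset.sum_const, Finset.card_univ, Fintype.card_fin,
      nsmul_eq_mul]
    ring_nf
  have hlarge : ∀ᶠ y in atTop, D < ∏ i, r y i := by
    simp_rw [hprod]
    exact (Real.tendsto_exp_atTop.comp (tendsto_id.const_mul_atTop
      (sub_pos.2 hεm))).eventually_gt_atTop D
  have hnorm : ∀ᶠ y : ℝ in atTop,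
      ∑ s, ‖(g (Sum.inr s) : EuclideanSpace ℝ (Fin p))‖ ≤ Real.exp (ε * y) :=
    (Real.tendsto_exp_atTop.comp (tendsto_id.const_mul_atTop hε)).eventually_ge_atTop _
  obtain ⟨y, h0, hDy, hny⟩ :=
    ((H.eventually_eq_zero hτ hinj hε).and (hlarge.and hnorm)).exists
  obtain ⟨x, hx, hx0, hxr⟩ := hD (r y)
    (fun i => by cases i <;> exact (Real.exp_pos _).le) hDy
  have hint : ((g.equivFun.symm x : Submodule.span ℝ V) : EuclideanSpace ℝ (Fin p)) ∈
      integerPoints p := by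
    clear hx0 hxr
    induction hx using Submodule.span_induction with
    | mem x hx =>
      obtain ⟨i, rfl⟩ := hx
      simpa using hf i
    | zero => exact ⟨0, by simp⟩
    | add x x' _ _ hx hx' =>
      rw [map_add]
      exact add_mem_integerPoints hx hx'
    | smul z x _ hx =>
      rw [map_zsmul]
      exact zsmul_mem_integerPoints z hx
  have hdecomp : ((g.equivFun.symm x : Submodule.span ℝ V) : EuclideanSpace ℝ (Fin p)) =
      ∑ j, x (Sum.inl j) • e j + ∑ s, x (Sum.inr s) • (g (Sum.inr s) : EuclideanSpace ℝ (Fin p)) := by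
    simp [Module.Basis.equivFun_symm_apply, hg]
  rw [hdecomp] at hint
  have hu : ‖∑ s, x (Sum.inr s) • (g (Sum.inr s) : EuclideanSpace ℝ (Fin p))‖ ≤
      Real.exp (-(1 + ε) * y) := by
    calc ‖∑ s, x (Sum.inr s) • (g (Sum.inr s) : EuclideanSpace ℝ (Fin p))‖
        ≤ ∑ s, Real.exp (-(1 + 2 * ε) * y) * ‖(g (Sum.inr s) : EuclideanSpace ℝ (Fin p))‖ := by
          refine (norm_sum_le _ _).trans (Finset.sum_le_sum fun s _ => ?_)
          rw [norm_smul, Real.norm_eq_abs]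
          gcongr
          exact hxr (Sum.inr s)
      _ ≤ Real.exp (-(1 + 2 * ε) * y) * Real.exp (ε * y) := by
          rw [← Finset.mul_sum]
          gcongr
      _ = Real.exp (-(1 + ε) * y) := by
          rw [← Real.exp_add]
          ring_nf
  have hz := h0 _ _ (fun j => hxr (Sum.inl j)) hu hint
  rw [← hdecomp, Submodule.coe_eq_zero, LinearEquiv.map_eq_zero_iff] at hz
  exact hx0 hz

end

/-! ### Subspaces defined over the rationals -/

/-- A finite family in a rational vector space is expanded along a `ℚ`-basis `b` of its span; the
coefficients are stored as one rational vector `r t` for each basis element `b t`. -/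
lemma exists_rational_decomposition {p : ℕ} {W : Type*} [AddCommGroup W] [Module ℚ W]
    (C : Fin p → W) : ∃ (d : ℕ) (b : Fin d → W) (r : Fin d → Fin p → ℚ),
      d = Module.finrank ℚ (Submodule.span ℚ (Set.range C)) ∧ LinearIndependent ℚ b ∧
        ∀ i, C i = ∑ t, r t i • b t := by
  have hfin : Module.Finite ℚ (Submodule.span ℚ (Set.range C)) :=
    Module.Finite.span_of_finite ℚ (Set.finite_range C)
  let B := Module.finBasis ℚ (Submodule.span ℚ (Set.range C))
  refine ⟨_, fun t => (B t : W), fun t i => B.repr ⟨C i, Submodule.subset_span ⟨i, rfl⟩⟩ t, rfl,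
    B.linearIndependent.map' (Submodule.subtype _) (Submodule.ker_subtype _), fun i => ?_⟩
  have := congrArg Subtype.val (B.sum_repr ⟨C i, Submodule.subset_span ⟨i, rfl⟩⟩)
  rw [Submodule.coe_sum] at this
  exact this.symm

/-- A subspace defined over `ℚ` is spanned by its rational points: when a vector of the subspace is
expanded along a `ℚ`-basis of the span of its coordinates, the resulting rational vectors satisfy
the same rational linear equations. -/
lemma DefinedOverRat.span_inter_rationalPoints {p : ℕ}
    {F : Submodule ℝ (EuclideanSpace ℝ (Fin p))} (hF : DefinedOverRat F) :
    Submodule.span ℝ ((F : Set (EuclideanSpace ℝ (Fin p))) ∩ rationalPoints p) = F := by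
  refine le_antisymm (Submodule.span_le.2 Set.inter_subset_left) fun x hx => ?_
  obtain ⟨S, hS⟩ := hF
  obtain ⟨d, b, r, -, hb, hr⟩ := exists_rational_decomposition (fun i => x i)
  let v : Fin d → EuclideanSpace ℝ (Fin p) := fun t => WithLp.toLp 2 fun i => (r t i : ℝ)
  have hv : ∀ t, v t ∈ F := fun t => by
    rw [hS]
    intro a ha
    have h1 : ∑ t, (∑ i, a i * r t i) • b t = 0 := by
      rw [← (hS x).1 hx a ha]
      simp only [hr, Finset.sum_smul, Finset.mul_sum, Rat.smul_def]
      rw [Finset.sum_comm]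
      refine Finset.sum_congr rfl fun i _ => Finset.sum_congr rfl fun t _ => ?_
      push_cast
      ring
    have h2 := Fintype.linearIndependent_iff.1 hb _ h1 t
    simp only [v]
    exact_mod_cast h2
  have hx' : x = ∑ t, b t • v t := by
    ext i
    simp [v, hr i, Rat.smul_def, mul_comm]
  rw [hx']
  exact Submodule.sum_mem _ fun t _ => Submodule.smul_mem _ _
    (Submodule.subset_span ⟨hv t, r t, fun i => rfl⟩)

lemma HasFormsAtAllScales.le_finrank_span_columns {k p : ℕ}
    {e : Fin k → EuclideanSpace ℝ (Fin p)} {τ : Fin k → ℝ} (H : HasFormsAtAllScales e τ)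
    (hτ : ∀ j, 0 < τ j) (hinj : Function.Injective τ) :
    (k : ℝ) + ∑ j, τ j ≤ Module.finrank ℚ
      (Submodule.span ℚ (Set.range (fun (i : Fin p) (j : Fin k) => e j i))) := by
  obtain ⟨d, b, r, hd, -, hr⟩ := exists_rational_decomposition
    (fun (i : Fin p) (j : Fin k) => e j i)
  rw [← hd]
  let v : Fin d → EuclideanSpace ℝ (Fin p) := fun t => WithLp.toLp 2 fun i => (r t i : ℝ)
  have he : ∀ j, e j ∈ Submodule.span ℝ (Set.range v) := fun j => by
    have : e j = ∑ t, b t j • v t := by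
      ext i
      simpa [v, Rat.smul_def, mul_comm] using congrFun (hr i) j
    rw [this]
    exact Submodule.sum_mem _ fun t _ => Submodule.smul_mem _ _ (Submodule.subset_span ⟨t, rfl⟩)
  refine (H.le_finrank_span hτ hinj (V := Set.range v) ?_ he).trans ?_
  · rintro _ ⟨t, rfl⟩
    exact ⟨r t, fun i => rfl⟩
  · exact_mod_cast (finrank_range_le_card (R := ℝ) v).trans_eq (Fintype.card_fin d)

/-! ### The convex body and the criterion -/

lemma HasFormsAtAllScales.exists_convexBody_inter_integerPoints {k p : ℕ}
    {e : Fin k → EuclideanSpace ℝ (Fin p)} {τ : Fin k → ℝ} (H : HasFormsAtAllScales e τ)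
    (hτ : ∀ j, 0 < τ j) (hinj : Function.Injective τ) {ε : ℝ} (hε : 0 < ε) :
    ∃ Q₀ : ℝ, ∀ R : ℝ, Q₀ ≤ R → convexBody e τ ε R ∩ integerPoints p = {0} := by
  refine eventually_atTop.1 ?_
  filter_upwards [Real.tendsto_log_atTop.eventually (H.eventually_eq_zero hτ hinj hε),
    eventually_gt_atTop 0] with R hR hR0
  ext x
  constructor
  · rintro ⟨⟨c, u, hc, -, hu, rfl⟩, hx⟩
    refine hR c u (fun j => ?_) ?_ hx
    · rw [mul_comm, ← Real.rpow_def_of_pos hR0]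
      exact hc j
    · rw [mul_comm, ← Real.rpow_def_of_pos hR0, neg_add']
      exact hu
  · rintro rfl
    refine ⟨⟨0, 0, fun j => ?_, Submodule.zero_mem _, ?_, by simp⟩, 0, by simp⟩
    · simpa using (Real.rpow_pos_of_pos hR0 _).le
    · simpa using (Real.rpow_pos_of_pos hR0 _).le

theorem theorem3 (k p : ℕ) (hk : 1 ≤ k) (hkp : k ≤ p - 1)
    (e : Fin k → EuclideanSpace ℝ (Fin p))
    (τ : Fin k → ℝ) (hτ_pos : ∀ j, 0 < τ j) (hτ_inj : Function.Injective τ)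
    (ω φ : Fin k → ℝ)
    (hωφ : {n : ℤ | ∀ j, ¬ (n * ω j + φ j ≡ Real.pi / 2 [PMOD Real.pi])}.Infinite)
    (Q : ℕ → ℕ) (hQ_pos : ∀ n, 1 ≤ n → 0 < Q n) (hQ_mono : MonotoneOn Q (Set.Ici 1))
    (hQ_lim : Filter.Tendsto Q Filter.atTop Filter.atTop)
    (hQ_growth :
      (∃ c : ℕ → ℝ, c =O[Filter.atTop] (fun n : ℕ => 1 / (n : ℝ)) ∧
        ∀ᶠ n in Filter.atTop, (Q (n + 1) : ℝ) = (Q n : ℝ) ^ (1 + c n)) ∨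
      ((∀ j, ω j = 0) ∧
        ∃ c : ℕ → ℝ, Filter.Tendsto c Filter.atTop (nhds 0) ∧
          ∀ᶠ n in Filter.atTop, (Q (n + 1) : ℝ) = (Q n : ℝ) ^ (1 + c n)))
    (l : ℕ → Fin p → ℤ)
    (hl_small : ∀ j, ∃ a b : ℕ → ℝ,
      Filter.Tendsto a Filter.atTop (nhds 0) ∧ Filter.Tendsto b Filter.atTop (nhds 0) ∧
        ∀ᶠ n in Filter.atTop,
          |integerForm (l n) (e j)| =
            (Q n : ℝ) ^ (-τ j + a n) * |Real.cos (n * ω j + φ j) + b n|)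
    (hl_coeff : ∃ d : ℕ → ℝ, Filter.Tendsto d Filter.atTop (nhds 0) ∧
      ∀ᶠ n in Filter.atTop, ∀ i, |(l n i : ℝ)| ≤ (Q n : ℝ) ^ (1 + d n)) :
    -- (i)
    ((∀ F : Submodule ℝ (EuclideanSpace ℝ (Fin p)), DefinedOverRat F → (∀ j, e j ∈ F) →
        (k : ℝ) + ∑ j, τ j ≤ (Module.finrank ℝ F : ℝ)) ∧
      (k : ℝ) + ∑ j, τ j ≤
        (Module.finrank ℚ
          (Submodule.span ℚ (Set.range (fun (i : Fin p) (j : Fin k) => e j i))) : ℝ)) ∧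
    -- (ii)
    (LinearIndependent ℝ e ∧
      Disjoint (Submodule.span ℝ (Set.range e) : Set (EuclideanSpace ℝ (Fin p)))
        (rationalPoints p \ {0})) ∧
    -- (iii)
    (∀ ε : ℝ, 0 < ε → ∃ Q₀ : ℝ, ∀ R : ℝ, Q₀ ≤ R →
      convexBody e τ ε R ∩ integerPoints p = {0}) := by
  obtain ⟨n₀, hn₀⟩ := hωφ.nonempty
  have hcos : ∀ j, Real.cos (n₀ * ω j + φ j) ≠ 0 := fun j h => by
    obtain ⟨m, hm⟩ := Real.cos_eq_zero_iff.1 h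
    refine hn₀ j (AddCommGroup.modEq_iff_zsmul.2 ⟨-m, ?_⟩)
    rw [hm, zsmul_eq_mul]
    push_cast
    ring
  -- both growth assumptions give `Q (n + 1) = Q n ^ (1 + o(1))`, which suffices
  obtain ⟨c, hc, hQc⟩ : ∃ c : ℕ → ℝ, Filter.Tendsto c Filter.atTop (nhds 0) ∧
      ∀ᶠ n in Filter.atTop, (Q (n + 1) : ℝ) = (Q n : ℝ) ^ (1 + c n) := by
    rcases hQ_growth with ⟨c, hc, h⟩ | ⟨-, h⟩
    · exact ⟨c, hc.trans_tendsto tendsto_one_div_atTop_nhds_zero_nat, h⟩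
    · exact h
  have H : HasFormsAtAllScales e τ :=
    hasFormsAtAllScales_of_oscillating hcos hQ_pos hQ_mono hQ_lim hc hQc l hl_small hl_coeff
  refine ⟨⟨fun F hF he => ?_, H.le_finrank_span_columns hτ_pos hτ_inj⟩,
    ⟨H.linearIndependent hτ_pos hτ_inj, H.disjoint_span_rationalPoints hτ_pos hτ_inj⟩,
    fun ε hε => H.exists_convexBody_inter_integerPoints hτ_pos hτ_inj hε⟩
  have hspan := hF.span_inter_rationalPoints
  rw [← hspan]
  exact H.le_finrank_span hτ_pos hτ_inj Set.inter_subset_right (by rwa [hspan])
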